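/- Let $U,V\in C^7(\mathbb R)$ be such that the derivatives of orders $2,\dots,7$ of $U$ and $V$ are bounded, and let $\lambda,K_V>0$ satisfy $\lambda\ge 7K_V$, where $(U'(x)-U'(y))(x-y)\ge\lambda|x-y|^2$ for all $x,y\in\mathbb R$, $V$ is even, $(V'(x)-V'(y))(x-y)\ge 0$ for all $x,y\in\mathbb R$, and $|V''|\le K_V$. Let $\sigma\in\mathbb R$. For $N\ge 1$, let $W=(W^1,\dots,W^N)$ be an $N$-dimensional standard Brownian motion relative to a filtration $(\mathcal F_r)_{r\ge 0}$, let $T\ge t\ge 0$, and let $x_1,\dots,x_N\in L^2$ be $\mathcal F_t$-measurable identically distributed real random variables. With $B_i(y)=-U'(y_i)-\frac1N\sum_{j=1}^N V'(y_i-y_j)$, let $\boldsymbol X_s=(X^{t,x_1,1,N}_s,\dots,X^{t,x_N,N,N}_s)$, $s\in[t,T]$, be the flow of the interacting particle system, $$X^{t,x_i,i,N}_s=x_i+\int_t^s B_i(\boldsymbol X_u)\,du+\sigma(W^i_s-W^i_t),\qquad 1\le i\le N.$$ Its variation processes are the continuous adapted solutions on $[t,T]$ of the following equations (obtained by formally differentiating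 the flow equation in the initial data). For $1\le i,j\le N$, $$X^{t,x_i,i,N}_{s,x_j}=\delta_{i,j}+\int_t^s\sum_{l=1}^N\partial_{x_l}B_i(\boldsymbol X_u)\,X^{t,x_l,l,N}_{u,x_j}\,du,$$ and for $k\ge 2$ and $j_1,\dots,j_k\in\{1,\dots,N\}$, $$X^{t,x_i,i,N}_{s,x_{j_1},\dots,x_{j_k}}=\int_t^s\Big(\sum_{l=1}^N\partial_{x_l}B_i(\boldsymbol X_u)\,X^{t,x_l,l,N}_{u,x_{j_1}}\Big)_{x_{j_2},\dots,x_{j_k}}du,$$ where the subscripts outside the brackets denote differentiation by the product rule (each subscript is distributed to either factor), $(X^{t,x_l,l,N}_{u,x_{a_1},\dots,x_{a_q}})_{x_b}=X^{t,x_l,l,N}_{u,x_{a_1},\dots,x_{a_q},x_b}$, and the chain rule $(\partial_{\beta}B_i(\boldsymbol X_u))_{x_b}=\sum_{l=1}^N\partial_{x_l}\partial_{\beta}B_i(\boldsymbol X_u)\,X^{t,x_l,l,N}_{u,x_b}$ for every iterated partial derivative $\partial_\beta$. For $\gamma=(\gamma_1,\dots,\gamma_{n+1})\in\{1,\dots,N\}^{n+1}$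 let $\hat{\mathcal O}(\gamma)$ be the number of distinct values among $\gamma_1,\dots,\gamma_{n+1}$. Then for every real $p\ge 2$ and every integer $1\le n\le 6$ there exist constants $\lambda_0^{(n)}\in(0,\lambda)$ and $K_1,K_2>0$, all independent of $s,t,T$ and $N$ and of the choice of probability space and starting points, such that for all $N\ge1$, all $0\le t\le s\le T$ and all $m\in\{1,\dots,n+1\}$ the following expectations are finite and $$\sum_{\gamma\in\{1,\dots,N\}^{n+1},\ \hat{\mathcal O}(\gamma)=m}\mathbb E\Big[\big|X^{t,x_{\gamma_1},\gamma_1,N}_{s,x_{\gamma_2},\dots,x_{\gamma_{n+1}}}\big|^p\Big]\le\frac{K_1}{N^{p(m-1)-m}}\,e^{-\lambda_0^{(n)}p(s-t)},$$ and, for every $\gamma\in\{1,\dots,N\}^{n+1}$ with $\hat{\mathcal O}(\gamma)=m$, $$\mathbb E\Big[\big|X^{t,x_{\gamma_1},\gamma_1,N}_{s,x_{\gamma_2},\dots,x_{\gamma_{n+1}}}\big|^p\Big]\le\frac{K_2}{N^{p(m-1)}}\,e^{-\lambda_0^{(n)}p(s-t)}.$$ -/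

import Mathlib

open MeasureTheory ProbabilityTheory
open scoped NNReal

namespace IPSVariation

/-- Standing assumptions on the confining potential `U` and the interaction potential `V`, with
convexity constant `lam` and interaction constant `KV`. Boundedness of the derivatives of orders
`1, …, 6` of `∇U` and `∇V` contains the global Lipschitz continuity of `∇U` and `∇V`. -/
structure PotentialAssumption (U V : ℝ → ℝ) (lam KV : ℝ) : Prop where
  lam_pos : 0 < lam
  KV_pos : 0 < KV
  contDiff_U : ContDiff ℝ 7 U
  contDiff_V : ContDiff ℝ 7 V
  bounded_U : ∀ k : ℕ, 2 ≤ k → k ≤ 7 → ∃ C : ℝ, ∀ x : ℝ, |iteratedDeriv k U x| ≤ C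
  bounded_V : ∀ k : ℕ, 2 ≤ k → k ≤ 7 → ∃ C : ℝ, ∀ x : ℝ, |iteratedDeriv k V x| ≤ C
  uniformly_convex_U : ∀ x y : ℝ, lam * |x - y| ^ 2 ≤ (deriv U x - deriv U y) * (x - y)
  even_V : ∀ x : ℝ, V (-x) = V x
  convex_V : ∀ x y : ℝ, 0 ≤ (deriv V x - deriv V y) * (x - y)
  hessian_V_le : ∀ x : ℝ, |iteratedDeriv 2 V x| ≤ KV
  seven_mul_KV_le : 7 * KV ≤ lam

/-- The drift `B_i(x) = -∇U(x_i) - (1/N) ∑_j ∇V(x_i - x_j)` of the `i`-th particle. -/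
noncomputable def drift (U V : ℝ → ℝ) {N : ℕ} (i : Fin N) (x : Fin N → ℝ) : ℝ :=
  -deriv U (x i) - (1 / (N : ℝ)) * ∑ j, deriv V (x i - x j)

/-- The iterated partial derivative `∂_{x_{b_1}} ⋯ ∂_{x_{b_k}} f` for `b = [b_1, …, b_k]`. -/
noncomputable def partialDeriv {N : ℕ} (f : (Fin N → ℝ) → ℝ) : List (Fin N) → (Fin N → ℝ) → ℝ
  | [] => f
  | l :: b => fun x => fderiv ℝ (partialDeriv f b) x (Pi.single l 1)

/-- All pairs `(α, β)` such that the given word is an interleaving of `α` and `β`. Each way of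
distributing the letters (as positions) is listed once, so repeated letters are counted with the
multiplicity required by the product rule. -/
def unshuffles {A : Type*} : List A → List (List A × List A)
  | [] => [([], [])]
  | a :: w => (unshuffles w).flatMap fun q => [(a :: q.1, q.2), (q.1, a :: q.2)]

theorem length_fst_le_of_mem_unshuffles {A : Type*} :
    ∀ (w : List A) (q : List A × List A), q ∈ unshuffles w → q.1.length ≤ w.length
  | [], q, h => by
      simp only [unshuffles, List.mem_singleton] at h
      simp [h]
  | a :: w, q, h => by
      simp only [unshuffles, List.mem_flatMap, List.mem_cons, List.not_mem_nil, or_false] at h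
      obtain ⟨r, hr, h | h⟩ := h
      · have := length_fst_le_of_mem_unshuffles w r hr
        simp [h, this]
      · have := length_fst_le_of_mem_unshuffles w r hr
        simp only [h, List.length_cons]
        omega

/-- The expression `(∂_b f (X))_{x_{α_1}, …, x_{α_k}}`: the derivative of `∂_b f (X)` with respect
to the initial data `x_{α_1}, …, x_{α_k}`, expanded by the chain rule and the product rule, where
`x` is the value of `X` and `y w l` is the value of `X^l_{x_{w_1}, x_{w_2}, …}`:
`(∂_b f (X))_{x_a} = ∑_l ∂_l ∂_b f (X) X^l_{x_a}`, and the remaining derivatives are distributed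
over the two factors of each product. -/
noncomputable def flowDeriv {N : ℕ} (f : (Fin N → ℝ) → ℝ) (x : Fin N → ℝ)
    (y : List (Fin N) → Fin N → ℝ) (b : List (Fin N)) : List (Fin N) → ℝ
  | [] => partialDeriv f b x
  | a :: α => ((unshuffles α).attach.map fun q =>
      ∑ l : Fin N, flowDeriv f x y (l :: b) q.1.1 * y (a :: q.1.2) l).sum
termination_by α => α.length
decreasing_by
  simp only [List.length_cons]
  have := length_fst_le_of_mem_unshuffles α q.1 q.2
  omega

theorem flowDeriv_nil {N : ℕ} (f : (Fin N → ℝ) → ℝ) (x : Fin N → ℝ)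
    (y : List (Fin N) → Fin N → ℝ) (b : List (Fin N)) :
    flowDeriv f x y b [] = partialDeriv f b x := by
  rw [flowDeriv]

theorem flowDeriv_cons {N : ℕ} (f : (Fin N → ℝ) → ℝ) (x : Fin N → ℝ)
    (y : List (Fin N) → Fin N → ℝ) (b : List (Fin N)) (a : Fin N) (α : List (Fin N)) :
    flowDeriv f x y b (a :: α) = ((unshuffles α).map fun q =>
      ∑ l : Fin N, flowDeriv f x y (l :: b) q.1 * y (a :: q.2) l).sum := by
  rw [flowDeriv]
  congr 1
  exact List.attach_map_val (l := unshuffles α) (f := fun q =>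
      ∑ l : Fin N, flowDeriv f x y (l :: b) q.1 * y (a :: q.2) l)

/-- The integrand of the equation of the variation process `X^i_{x_{γ_1}, …, x_{γ_n}}`:
`∑_l ∂_l B_i(X) X^l_{x_{γ_1}, …, x_{γ_n}}
  + ∑_{(α, β), |α| > 0} ∑_l (∂_l B_i(X))_{x_α} (X^l_{x_{γ_1}})_{x_β}`,
the second sum being over the ways to obtain `(γ_2, …, γ_n)` as a shuffle of `α` and `β`. -/
noncomputable def variationRate (U V : ℝ → ℝ) {N : ℕ} (x : Fin N → ℝ)
    (y : List (Fin N) → Fin N → ℝ) (i : Fin N) : List (Fin N) → ℝ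
  | [] => 0
  | a :: w =>
      (∑ l : Fin N, partialDeriv (drift U V i) [l] x * y (a :: w) l) +
        (((unshuffles w).filter fun q => 0 < q.1.length).map fun q =>
          ∑ l : Fin N, flowDeriv (drift U V i) x y [l] q.1 * y (a :: q.2) l).sum

/-- The initial value of a variation process: `δ_{i,j}` for the first variation `X^i_{x_j}`, and
`0` for the higher ones. -/
noncomputable def variationInit {N : ℕ} (i : Fin N) (w : List (Fin N)) : ℝ :=
  if w = [i] then 1 else 0

/-- `W = (W^1, …, W^N)` is an `N`-dimensional standard Brownian motion relative to `𝓕`. -/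
structure IsFilteredBrownian {Ω : Type*} [mΩ : MeasurableSpace Ω] (P : Measure Ω)
    (𝓕 : Filtration ℝ≥0 mΩ) {N : ℕ} (W : Fin N → ℝ≥0 → Ω → ℝ) : Prop where
  brownian : ∀ i, IsBrownianReal (W i) P
  indep : iIndepFun (fun i ω (r : ℝ≥0) => W i r ω) P
  adapted : ∀ i r, Measurable[𝓕 r] (W i r)
  indep_increments : ∀ q r : ℝ≥0, q ≤ r →
    Indep (MeasurableSpace.comap (fun ω (i : Fin N) => W i r ω - W i q ω) inferInstance) (𝓕 q) P

/-- `X = (X^{t,x_1,1,N}, …, X^{t,x_N,N,N})` is the continuous adapted solution on `[t, T]` of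
`X^i_s = x_i + ∫_t^s B_i(X_u) du + σ (W^i_s - W^i_t)`. -/
structure IsParticleFlow {Ω : Type*} [mΩ : MeasurableSpace Ω] (P : Measure Ω)
    (𝓕 : Filtration ℝ≥0 mΩ) (U V : ℝ → ℝ) (σ : ℝ) {N : ℕ} (W : Fin N → ℝ≥0 → Ω → ℝ)
    (t T : ℝ≥0) (x : Fin N → Ω → ℝ) (X : ℝ≥0 → Ω → Fin N → ℝ) : Prop where
  adapted : ∀ r ∈ Set.Icc t T, Measurable[𝓕 r] (X r)
  continuousOn : ∀ᵐ ω ∂P, ContinuousOn (fun r => X r ω) (Set.Icc t T)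
  equation : ∀ᵐ ω ∂P, ∀ s ∈ Set.Icc t T, ∀ i : Fin N,
    X s ω i = x i ω + (∫ u in (t : ℝ)..(s : ℝ), drift U V i (X u.toNNReal ω))
      + σ * (W i s ω - W i t ω)

/-- `Y w i s` is the variation process `X^{t,x_i,i,N}_{s,x_{w_1},…,x_{w_k}}` of the flow `X`, for
all words `w` of length `k = 1, …, n`: the `Y w i` are the continuous adapted solutions on `[t, T]`
of the variation equations of orders `1, …, n`. -/
structure IsVariationProcess {Ω : Type*} [mΩ : MeasurableSpace Ω] (P : Measure Ω)
    (𝓕 : Filtration ℝ≥0 mΩ) (U V : ℝ → ℝ) {N : ℕ} (t T : ℝ≥0) (X : ℝ≥0 → Ω → Fin N → ℝ)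
    (n : ℕ) (Y : List (Fin N) → Fin N → ℝ≥0 → Ω → ℝ) : Prop where
  adapted : ∀ w : List (Fin N), 1 ≤ w.length → w.length ≤ n → ∀ i : Fin N,
    ∀ r ∈ Set.Icc t T, Measurable[𝓕 r] (Y w i r)
  continuousOn : ∀ w : List (Fin N), 1 ≤ w.length → w.length ≤ n → ∀ i : Fin N,
    ∀ᵐ ω ∂P, ContinuousOn (fun r => Y w i r ω) (Set.Icc t T)
  equation : ∀ w : List (Fin N), 1 ≤ w.length → w.length ≤ n → ∀ i : Fin N,
    ∀ᵐ ω ∂P, ∀ s ∈ Set.Icc t T,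
      Y w i s ω = variationInit i w + ∫ u in (t : ℝ)..(s : ℝ),
        variationRate U V (X u.toNNReal ω) (fun v l => Y v l u.toNNReal ω) i w

/-- The frequency of `j` in the multi-index `γ`. -/
def frequency {n N : ℕ} (γ : Fin n → Fin N) (j : Fin N) : ℕ :=
  (Finset.univ.filter fun k => γ k = j).card

/-- `Ô(γ)`: the number of indices `j` whose frequency in `γ` is non-zero. -/
def orderHat {n N : ℕ} (γ : Fin n → Fin N) : ℕ :=
  (Finset.univ.filter fun j => frequency γ j ≠ 0).card

/-- For `γ = (γ_1, …, γ_{n+1})`, the process `X^{t,x_{γ_1},γ_1,N}_{s,x_{γ_2},…,x_{γ_{n+1}}}`. -/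
def component {Ω : Type*} {N n : ℕ} (Y : List (Fin N) → Fin N → ℝ≥0 → Ω → ℝ)
    (γ : Fin (n + 1) → Fin N) (s : ℝ≥0) (ω : Ω) : ℝ :=
  Y (List.ofFn fun k : Fin n => γ k.succ) (γ 0) s ω

end IPSVariation

/-!
The moment bounds hold because the variation processes obey the same bounds along every path, with
deterministic constants: the noise enters the variation equations only through the point at which
the derivatives of the drift are taken, and these derivatives are bounded.

Fix a path. The variation process of a word `w` solves a linear system `z' = M z + g`, where `M` is
the Jacobian of the drift and `g` contains variation processes of lower order only. As `V`
is convex, `M` is minus the confinement `U'' ≥ lam` plus `N⁻¹` times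
a weighted graph Laplacian with nonnegative off-diagonal entries, so strict supersolutions dominate
solutions (`abs_le_of_strict_supersolution`).

Sizes are measured by `weight S = N ^ (1 - |S|)`, where `S` is the set of the indices involved. A
derivative of the drift of particle `i` in the directions `b` has size `weight ({i} ∪ b)`
(`exists_abs_partialDeriv_drift_le`), and weights are stable under the contractions `∑ l` of the
chain and product rules: two factors that share `l` satisfy
`weight ({l} ∪ S) * weight ({l} ∪ T) ≤ weight ({l} ∪ S ∪ T)`, and summing over `l` costs only a
constant (`abs_sum_mul_le`). By induction on the order, `g` has size `weight ({i} ∪ w)` and decays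
like `exp (-lam (s - t) / 2)`. A supersolution of the same size and decay rate is `profile`, which
is of order `weight w` on the letters of `w` and a factor `N⁻¹` smaller elsewhere; half of the
confinement pays for the decay rate and the other half for the interaction and for `g`
(`exists_abs_variation_le`).

Taking `p`-th powers gives the bound for each multi-index, and the bound for the sum follows as
there are at most a constant times `N ^ m` multi-indices with `m` distinct values
(`card_orderHat_eq_le`).
-/

namespace IPSVariation

/-! ### Weights of finite sets of particles -/

/-- The weight `N ^ (1 - |S|)` of a set `S` of particles, written as `N * N⁻¹ ^ |S|`; it is the
order of magnitude of a variation process whose indices have the set of values `S`. -/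
noncomputable def weight {N : ℕ} (S : Finset (Fin N)) : ℝ := (N : ℝ) * (N : ℝ)⁻¹ ^ S.card

theorem weight_pos {N : ℕ} (hN : 1 ≤ N) (S : Finset (Fin N)) : 0 < weight S := by
  have : (0 : ℝ) < N := by exact_mod_cast hN
  unfold weight
  positivity

theorem weight_insert_of_notMem {N : ℕ} {S : Finset (Fin N)} {l : Fin N} (hl : l ∉ S) :
    weight (insert l S) = (N : ℝ)⁻¹ * weight S := by
  unfold weight
  rw [Finset.card_insert_of_notMem hl, pow_succ]
  ring

theorem weight_singleton {N : ℕ} (hN : 1 ≤ N) (i : Fin N) : weight {i} = 1 := by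
  have : (N : ℝ) ≠ 0 := by positivity
  simp [weight, this]

theorem weight_mul_le {N : ℕ} (hN : 1 ≤ N) (S T : Finset (Fin N)) (l : Fin N) :
    weight (insert l S) * weight (insert l T) ≤ weight (insert l (S ∪ T)) := by
  have h1 : (1 : ℝ) ≤ N := by exact_mod_cast hN
  have h0 : (N : ℝ) ≠ 0 := by positivity
  have hinv : (N : ℝ)⁻¹ ≤ 1 := inv_le_one_of_one_le₀ h1
  have hc : (insert l (S ∪ T)).card + 1 ≤ (insert l S).card + (insert l T).card := by
    rw [← Finset.card_union_add_card_inter, ← Finset.insert_union_distrib]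
    have : 0 < (insert l S ∩ insert l T).card :=
      Finset.card_pos.2 ⟨l, by simp⟩
    omega
  have := pow_le_pow_of_le_one (by positivity) hinv hc
  unfold weight
  calc _ = (N : ℝ) ^ 2 * (N : ℝ)⁻¹ ^ ((insert l S).card + (insert l T).card) := by
        rw [pow_add]; ring
    _ ≤ (N : ℝ) ^ 2 * (N : ℝ)⁻¹ ^ ((insert l (S ∪ T)).card + 1) := by gcongr
    _ = _ := by
        rw [pow_succ (N : ℝ)⁻¹, sq]
        calc _ = (N : ℝ) * (N : ℝ)⁻¹ ^ (insert l (S ∪ T)).card * ((N : ℝ) * (N : ℝ)⁻¹) := by ring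
          _ = _ := by rw [mul_inv_cancel₀ h0, mul_one]

/-- Summing over a further index costs no power of `N`: it is either one of the boundedly many
indices in `S`, or it is one of `N` indices that each gain a factor `N⁻¹`. -/
theorem sum_weight_insert_le {N : ℕ} (hN : 1 ≤ N) (S : Finset (Fin N)) :
    ∑ l, weight (insert l S) ≤ (S.card + 1) * weight S := by
  have h0 : (N : ℝ) ≠ 0 := by positivity
  have hw := weight_pos hN S
  calc ∑ l, weight (insert l S)
      ≤ ∑ l, ((if l ∈ S then weight S else 0) + (N : ℝ)⁻¹ * weight S) := by
        refine Finset.sum_le_sum fun l _ => ?_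
        by_cases hl : l ∈ S
        · simp only [Finset.insert_eq_of_mem hl, hl, if_true]
          have : 0 ≤ (N : ℝ)⁻¹ * weight S := by positivity
          linarith
        · simp [weight_insert_of_notMem hl, hl]
    _ = (S.card + 1) * weight S := by
        rw [Finset.sum_add_distrib]
        simp
        field_simp

theorem abs_sum_mul_le {N : ℕ} (hN : 1 ≤ N) (S T : Finset (Fin N)) {f g : Fin N → ℝ} {C D : ℝ}
    (hC : 0 ≤ C) (hD : 0 ≤ D)
    (hf : ∀ l, |f l| ≤ C * weight (insert l S)) (hg : ∀ l, |g l| ≤ D * weight (insert l T)) :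
    |∑ l, f l * g l| ≤ C * D * ((S ∪ T).card + 1) * weight (S ∪ T) := by
  calc |∑ l, f l * g l| ≤ ∑ l, |f l * g l| := Finset.abs_sum_le_sum_abs _ _
    _ ≤ ∑ l, C * D * weight (insert l (S ∪ T)) := by
        refine Finset.sum_le_sum fun l _ => ?_
        have h1 := weight_pos hN (insert l S)
        rw [abs_mul]
        calc |f l| * |g l| ≤ (C * weight (insert l S)) * (D * weight (insert l T)) := by
              gcongr
              · exact hf l
              · exact hg l
          _ = C * D * (weight (insert l S) * weight (insert l T)) := by ring
          _ ≤ _ := by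
              gcongr
              exact weight_mul_le hN S T l
    _ ≤ _ := by
        rw [← Finset.mul_sum, mul_assoc (C * D)]
        gcongr
        exact sum_weight_insert_le hN _

/-! ### Unshuffles -/

theorem length_of_mem_unshuffles {A : Type*} :
    ∀ {w : List A} {q : List A × List A}, q ∈ unshuffles w →
      q.1.length + q.2.length = w.length
  | [], q, h => by
      simp only [unshuffles, List.mem_singleton] at h
      simp [h]
  | a :: w, q, h => by
      simp only [unshuffles, List.mem_flatMap, List.mem_cons, List.not_mem_nil, or_false] at h
      obtain ⟨r, hr, h | h⟩ := h <;>
      · have := length_of_mem_unshuffles hr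
        simp only [h, List.length_cons]
        omega

theorem toFinset_of_mem_unshuffles {A : Type*} [DecidableEq A] :
    ∀ {w : List A} {q : List A × List A}, q ∈ unshuffles w →
      q.1.toFinset ∪ q.2.toFinset = w.toFinset
  | [], q, h => by
      simp only [unshuffles, List.mem_singleton] at h
      simp [h]
  | a :: w, q, h => by
      simp only [unshuffles, List.mem_flatMap, List.mem_cons, List.not_mem_nil, or_false] at h
      obtain ⟨r, hr, h | h⟩ := h <;>
      · have := toFinset_of_mem_unshuffles hr
        simp [h, ← this]

theorem length_unshuffles {A : Type*} : ∀ w : List A, (unshuffles w).length = 2 ^ w.length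
  | [] => rfl
  | a :: w => by
      simp [unshuffles, List.length_flatMap, length_unshuffles w, pow_succ]

theorem abs_list_sum_map_le {A : Type*} (L : List A) (f : A → ℝ) {c : ℝ}
    (h : ∀ q ∈ L, |f q| ≤ c) : |(L.map f).sum| ≤ L.length * c := by
  induction L with
  | nil => simp
  | cons a L ih =>
      simp only [List.map_cons, List.sum_cons, List.length_cons, Nat.cast_add, Nat.cast_one]
      have h1 := h a (by simp)
      have h2 := ih fun q hq => h q (by simp [hq])
      have := abs_add_le (f a) (L.map f).sum
      linarith

/-! ### Partial derivatives of the drift -/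

/-- The iterated partial derivative of the drift along the word `b`: each letter contributes the
derivative of the argument `x_i`, resp. `x_i - x_j`, of the potential in that direction. -/
theorem partialDeriv_drift {U V : ℝ → ℝ} (hU : ContDiff ℝ 7 U) (hV : ContDiff ℝ 7 V) {N : ℕ}
    (i : Fin N) : ∀ b : List (Fin N), b.length ≤ 6 →
    partialDeriv (drift U V i) b = fun x =>
      -((b.map fun l => (Pi.single l 1 : Fin N → ℝ) i).prod
          * iteratedDeriv (b.length + 1) U (x i))
        - (1 / (N : ℝ)) * ∑ j,
          (b.map fun l => (Pi.single l 1 : Fin N → ℝ) i - (Pi.single l 1 : Fin N → ℝ) j).prod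
            * iteratedDeriv (b.length + 1) V (x i - x j)
  | [], _ => by
      funext x
      simp [partialDeriv, drift, iteratedDeriv_one]
  | l :: b, hb => by
      have hb' : b.length + 1 ≤ 6 := by simpa using hb
      have key : ∀ {f : ℝ → ℝ}, ContDiff ℝ 7 f → ∀ r,
          HasDerivAt (iteratedDeriv (b.length + 1) f) (iteratedDeriv (b.length + 1 + 1) f r) r := by
        intro f hf r
        rw [iteratedDeriv_succ (n := b.length + 1)]
        refine (hf.differentiable_iteratedDeriv (b.length + 1) ?_ r).hasDerivAt
        exact_mod_cast (by omega : b.length + 1 < 7)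
      funext x
      have hi : ∀ j : Fin N, HasFDerivAt (fun x : Fin N → ℝ => x j)
          (ContinuousLinearMap.proj (R := ℝ) (φ := fun _ : Fin N => ℝ) j) x :=
        fun j => hasFDerivAt_apply j x
      have h1 := ((key hU (x i)).comp_hasFDerivAt x (hi i)).const_mul
        (b.map fun l => (Pi.single l 1 : Fin N → ℝ) i).prod
      have h2 := fun j : Fin N => ((key hV (x i - x j)).comp_hasFDerivAt x
        ((hi i).sub (hi j))).const_mul
        (b.map fun l => (Pi.single l 1 : Fin N → ℝ) i - (Pi.single l 1 : Fin N → ℝ) j).prod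
      have h3 := h1.neg.sub ((HasFDerivAt.fun_sum fun j (_ : j ∈ Finset.univ) => h2 j).const_mul
        (1 / (N : ℝ)))
      rw [partialDeriv, partialDeriv_drift hU hV i b (by omega)]
      refine (congrArg (fun L : (Fin N → ℝ) →L[ℝ] ℝ => L (Pi.single l 1)) h3.fderiv).trans ?_
      simp only [sub_apply, neg_apply,
        smul_apply, sum_apply,
        ContinuousLinearMap.proj_apply, smul_eq_mul, List.map_cons, List.prod_cons,
        List.length_cons]
      congr 1
      · ring
      · congr 1
        exact Finset.sum_congr rfl fun j _ => by ring

theorem continuous_partialDeriv_drift {U V : ℝ → ℝ} (hU : ContDiff ℝ 7 U) (hV : ContDiff ℝ 7 V)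
    {N : ℕ} (i : Fin N) (b : List (Fin N)) (hb : b.length ≤ 6) :
    Continuous (partialDeriv (drift U V i) b) := by
  rw [partialDeriv_drift hU hV i b hb]
  have hle : ((b.length + 1 : ℕ) : WithTop ℕ∞) ≤ 7 := by
    exact_mod_cast (by omega : b.length + 1 ≤ 7)
  have h1 := hU.continuous_iteratedDeriv (b.length + 1) hle
  have h2 := hV.continuous_iteratedDeriv (b.length + 1) hle
  fun_prop

theorem abs_prod_map_le_one {A : Type*} (b : List A) (f : A → ℝ) (h : ∀ l ∈ b, |f l| ≤ 1) :
    |(b.map f).prod| ≤ 1 := by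
  induction b with
  | nil => simp
  | cons a b ih =>
      rw [List.map_cons, List.prod_cons, abs_mul]
      exact mul_le_one₀ (h a (by simp)) (abs_nonneg _) (ih fun l hl => h l (by simp [hl]))

/-- The derivatives of orders `1, …, 6` of the drift of particle `i` are bounded, and every
index of differentiation that is new gains a factor `N⁻¹`. -/
theorem exists_abs_partialDeriv_drift_le {U V : ℝ → ℝ} {lam KV : ℝ}
    (h : PotentialAssumption U V lam KV) :
    ∃ C : ℝ, 0 ≤ C ∧ ∀ N : ℕ, 1 ≤ N → ∀ (i : Fin N) (b : List (Fin N)), 1 ≤ b.length →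
      b.length ≤ 6 → ∀ x, |partialDeriv (drift U V i) b x| ≤ C * weight (insert i b.toFinset) := by
  have uniform : ∀ f : ℝ → ℝ, (∀ k : ℕ, 2 ≤ k → k ≤ 7 → ∃ C : ℝ, ∀ x, |iteratedDeriv k f x| ≤ C) →
      ∃ C : ℝ, 0 ≤ C ∧ ∀ k, 2 ≤ k → k ≤ 7 → ∀ x, |iteratedDeriv k f x| ≤ C := by
    intro f hf
    have : ∀ k : ℕ, ∃ C : ℝ, 2 ≤ k → k ≤ 7 → ∀ x, |iteratedDeriv k f x| ≤ C := by
      intro k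
      by_cases hk : 2 ≤ k ∧ k ≤ 7
      · obtain ⟨C, hC⟩ := hf k hk.1 hk.2
        exact ⟨C, fun _ _ => hC⟩
      · exact ⟨0, fun h1 h2 => absurd ⟨h1, h2⟩ hk⟩
    choose c hc using this
    refine ⟨∑ k ∈ Finset.range 8, |c k|, by positivity, fun k h2 h7 x => ?_⟩
    refine (hc k h2 h7 x).trans ((le_abs_self _).trans ?_)
    exact Finset.single_le_sum (f := fun k => |c k|) (fun _ _ => abs_nonneg _)
      (Finset.mem_range.2 (by omega))
  obtain ⟨CU, hCU0, hCU⟩ := uniform U h.bounded_U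
  obtain ⟨CV, hCV0, hCV⟩ := uniform V h.bounded_V
  -- `8` bounds `card S + 1`, as `S` consists of `i` and the at most six letters of `b`
  refine ⟨CU + CV * 8, by positivity, fun N hN i b hb1 hb6 x => ?_⟩
  rw [partialDeriv_drift h.contDiff_U h.contDiff_V i b hb6]
  set S := insert i b.toFinset with hS
  have hw := weight_pos hN S
  have hN0 : (0 : ℝ) < N := by exact_mod_cast hN
  have hcard : (S.card : ℝ) + 1 ≤ 8 := by
    have h1 := Finset.card_insert_le i b.toFinset
    have h2 := b.toFinset_card_le
    have : S.card + 1 ≤ 8 := by rw [hS]; omega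
    exact_mod_cast this
  -- the confinement only contributes if every letter of `b` is `i`
  have hfirst : |(b.map fun l => (Pi.single l 1 : Fin N → ℝ) i).prod
      * iteratedDeriv (b.length + 1) U (x i)| ≤ CU * weight S := by
    by_cases hb : ∀ l ∈ b, l = i
    · have hSi : S = {i} := by
        ext l
        simp only [hS, Finset.mem_insert, List.mem_toFinset, Finset.mem_singleton]
        exact ⟨fun hl => hl.elim id (hb l), Or.inl⟩
      rw [hSi, weight_singleton hN, abs_mul, mul_one]
      refine (mul_le_of_le_one_left (abs_nonneg _) (abs_prod_map_le_one _ _ fun l hl => ?_)).trans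
        (hCU _ (by omega) (by omega) _)
      simp [hb l hl]
    · push Not at hb
      obtain ⟨l, hl, hli⟩ := hb
      have : (b.map fun l => (Pi.single l 1 : Fin N → ℝ) i).prod = 0 :=
        List.prod_eq_zero (List.mem_map.2 ⟨l, hl, by simp [hli.symm]⟩)
      rw [this]
      simp only [zero_mul, abs_zero]
      positivity
  -- the interaction with `j` only contributes if every letter of `b` is `i` or `j`, and `j ≠ i`
  have hsecond : ∀ j, |(1 / (N : ℝ)) * ((b.map fun l =>
      (Pi.single l 1 : Fin N → ℝ) i - (Pi.single l 1 : Fin N → ℝ) j).prod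
        * iteratedDeriv (b.length + 1) V (x i - x j))| ≤ CV * weight (insert j S) := by
    intro j
    have hwj := weight_pos hN (insert j S)
    by_cases hij : j = i
    · have : (b.map fun l =>
          (Pi.single l 1 : Fin N → ℝ) i - (Pi.single l 1 : Fin N → ℝ) j).prod = 0 := by
        obtain ⟨l, b, rfl⟩ := List.exists_cons_of_length_pos hb1
        simp [hij]
      rw [this]
      simp only [zero_mul, mul_zero, abs_zero]
      positivity
    by_cases hb : ∀ l ∈ b, l = i ∨ l = j
    · have hSi : insert j S = insert j {i} := by
        ext l
        simp only [hS, Finset.mem_insert, List.mem_toFinset, Finset.mem_singleton]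
        constructor
        · rintro (hl | hl | hl)
          · exact Or.inl hl
          · exact Or.inr hl
          · exact (hb l hl).symm
        · rintro (hl | hl)
          · exact Or.inl hl
          · exact Or.inr (Or.inl hl)
      rw [hSi, weight_insert_of_notMem (by simpa using hij), weight_singleton hN, abs_mul, abs_mul,
        abs_of_pos (by positivity), mul_one, one_div, mul_comm CV]
      gcongr
      refine (mul_le_of_le_one_left (abs_nonneg _) (abs_prod_map_le_one _ _ fun l hl => ?_)).trans
        (hCV _ (by omega) (by omega) _)
      rcases hb l hl with rfl | rfl
      · simp [hij]
      · simp [Ne.symm hij]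
    · push Not at hb
      obtain ⟨l, hl, hli, hlj⟩ := hb
      have : (b.map fun l =>
          (Pi.single l 1 : Fin N → ℝ) i - (Pi.single l 1 : Fin N → ℝ) j).prod = 0 :=
        List.prod_eq_zero
          (List.mem_map.2 ⟨l, hl, by simp [hli.symm, hlj.symm]⟩)
      rw [this]
      simp only [zero_mul, mul_zero, abs_zero]
      positivity
  refine (abs_sub _ _).trans ?_
  rw [abs_neg, add_mul, Finset.mul_sum]
  refine add_le_add hfirst ((Finset.abs_sum_le_sum_abs _ _).trans
    ((Finset.sum_le_sum fun j _ => hsecond j).trans ?_))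
  rw [← Finset.mul_sum, mul_assoc]
  gcongr
  exact (sum_weight_insert_le hN S).trans (by gcongr)

theorem partialDeriv_drift_singleton {U V : ℝ → ℝ} (hU : ContDiff ℝ 7 U) (hV : ContDiff ℝ 7 V)
    {N : ℕ} (i l : Fin N) (x : Fin N → ℝ) :
    partialDeriv (drift U V i) [l] x =
      -((Pi.single l 1 : Fin N → ℝ) i * iteratedDeriv 2 U (x i))
        - (1 / (N : ℝ)) * ∑ j, ((Pi.single l 1 : Fin N → ℝ) i - (Pi.single l 1 : Fin N → ℝ) j)
            * iteratedDeriv 2 V (x i - x j) := by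
  rw [partialDeriv_drift hU hV i [l] (by simp)]
  simp

/-- The Jacobian of the drift acts as minus the confinement plus a weighted graph Laplacian. -/
theorem sum_partialDeriv_drift_mul {U V : ℝ → ℝ} (hU : ContDiff ℝ 7 U) (hV : ContDiff ℝ 7 V)
    {N : ℕ} (i : Fin N) (x h : Fin N → ℝ) :
    ∑ l, partialDeriv (drift U V i) [l] x * h l =
      -(iteratedDeriv 2 U (x i) * h i)
        + (1 / (N : ℝ)) * ∑ j, iteratedDeriv 2 V (x i - x j) * (h j - h i) := by
  have hs : ∀ j, ∑ l, (Pi.single l 1 : Fin N → ℝ) j * h l = h j := fun j => by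
    simp [Pi.single_apply]
  simp only [partialDeriv_drift_singleton hU hV, sub_mul, neg_mul, Finset.sum_sub_distrib,
    Finset.sum_neg_distrib]
  have h1 : ∑ l, (Pi.single l 1 : Fin N → ℝ) i * iteratedDeriv 2 U (x i) * h l
      = iteratedDeriv 2 U (x i) * h i := by
    rw [← hs i, Finset.mul_sum]
    exact Finset.sum_congr rfl fun l _ => by ring
  have h2 : ∀ j, ∑ l, ((Pi.single l 1 : Fin N → ℝ) i * iteratedDeriv 2 V (x i - x j) * h l
      - (Pi.single l 1 : Fin N → ℝ) j * iteratedDeriv 2 V (x i - x j) * h l)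
      = iteratedDeriv 2 V (x i - x j) * (h i - h j) := by
    intro j
    rw [← hs i, ← hs j, ← Finset.sum_sub_distrib, Finset.mul_sum]
    exact Finset.sum_congr rfl fun l _ => by ring
  have h3 : ∑ l, 1 / (N : ℝ) * (∑ j, (Pi.single l 1 : Fin N → ℝ) i * iteratedDeriv 2 V (x i - x j)
      - ∑ j, (Pi.single l 1 : Fin N → ℝ) j * iteratedDeriv 2 V (x i - x j)) * h l
      = (1 / (N : ℝ)) * ∑ j, iteratedDeriv 2 V (x i - x j) * (h i - h j) := by
    simp only [← h2, Finset.mul_sum]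
    rw [Finset.sum_comm]
    refine Finset.sum_congr rfl fun l _ => ?_
    rw [← Finset.sum_sub_distrib, Finset.mul_sum, Finset.sum_mul]
    exact Finset.sum_congr rfl fun j _ => by ring
  rw [h1, h3, sub_eq_add_neg, ← mul_neg (1 / (N : ℝ)), ← Finset.sum_neg_distrib]
  congr 2
  exact Finset.sum_congr rfl fun j _ => by ring

theorem partialDeriv_drift_nonneg {U V : ℝ → ℝ} (hU : ContDiff ℝ 7 U) (hV : ContDiff ℝ 7 V)
    (hV0 : ∀ r, 0 ≤ iteratedDeriv 2 V r) {N : ℕ} {i l : Fin N} (hil : l ≠ i) (x : Fin N → ℝ) :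
    0 ≤ partialDeriv (drift U V i) [l] x := by
  rw [partialDeriv_drift_singleton hU hV]
  simp only [Pi.single_apply, hil.symm, if_false, zero_mul, neg_zero, zero_sub, neg_mul,
    Finset.sum_neg_distrib, mul_neg, neg_neg]
  refine mul_nonneg (by positivity) (Finset.sum_nonneg fun j _ => mul_nonneg ?_ (hV0 _))
  split_ifs <;> norm_num

theorem le_deriv_of_monotone_bound {f : ℝ → ℝ} {f' c r : ℝ} (hf : HasDerivAt f f' r)
    (h : ∀ x y, c * |x - y| ^ 2 ≤ (f x - f y) * (x - y)) : c ≤ f' := by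
  have ht := hf.tendsto_slope
  refine ge_of_tendsto ht ?_
  filter_upwards [self_mem_nhdsWithin] with x hx
  have hx' : x - r ≠ 0 := sub_ne_zero.2 hx
  rw [slope_def_field]
  have h2 : 0 < (x - r) ^ 2 := by positivity
  have := h x r
  rw [sq_abs] at this
  refine le_of_mul_le_mul_right (this.trans_eq ?_) h2
  field_simp

theorem PotentialAssumption.lam_le {U V : ℝ → ℝ} {lam KV : ℝ}
    (h : PotentialAssumption U V lam KV) (r : ℝ) : lam ≤ iteratedDeriv 2 U r := by
  have hd := (h.contDiff_U.differentiable_iteratedDeriv 1 (by norm_num) r).hasDerivAt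
  rw [← iteratedDeriv_succ, iteratedDeriv_one] at hd
  exact le_deriv_of_monotone_bound hd h.uniformly_convex_U

theorem PotentialAssumption.hessian_V_nonneg {U V : ℝ → ℝ} {lam KV : ℝ}
    (h : PotentialAssumption U V lam KV) (r : ℝ) : 0 ≤ iteratedDeriv 2 V r := by
  have hd := (h.contDiff_V.differentiable_iteratedDeriv 1 (by norm_num) r).hasDerivAt
  rw [← iteratedDeriv_succ, iteratedDeriv_one] at hd
  exact le_deriv_of_monotone_bound hd fun x y => by simpa using h.convex_V x y

/-! ### A comparison principle for cooperative linear systems -/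

open Set Filter Topology in
theorem eventually_nonpos_of_deriv_neg {f : ℝ → ℝ} {f' s : ℝ}
    (hf : HasDerivWithinAt f f' (Ici s) s) (h0 : f s ≤ 0) (h : f s = 0 → f' < 0) :
    ∀ᶠ r in 𝓝[>] s, f r ≤ 0 := by
  rcases h0.lt_or_eq with hlt | heq
  · have hc : Tendsto f (𝓝[>] s) (𝓝 (f s)) :=
      hf.continuousWithinAt.tendsto.mono_left (nhdsWithin_mono _ Ioi_subset_Ici_self)
    filter_upwards [hc.eventually (gt_mem_nhds hlt)] with r hr using hr.le
  · have ht := (hasDerivWithinAt_iff_tendsto_slope' (lt_irrefl s)).1 hf.Ioi_of_Ici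
    filter_upwards [ht.eventually (gt_mem_nhds (h heq)), self_mem_nhdsWithin] with r hr hs
    rw [slope_def_field, heq, sub_zero] at hr
    have : 0 < r - s := sub_pos.2 hs
    by_contra hcon
    push Not at hcon
    exact absurd hr (not_lt.2 (by positivity))

open Set Filter Topology in
/-- If the off-diagonal coefficients of a linear system are nonnegative, then a strict
supersolution `B` dominates the solutions. Where `z i` touches the barrier `B i`, the other
components are below theirs, so `z i` grows more slowly than `B i`. -/
theorem abs_le_of_strict_supersolution {ι : Type*} [Fintype ι] {a b : ℝ} {z g B B' : ι → ℝ → ℝ}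
    {M : ℝ → ι → ι → ℝ}
    (hz : ∀ i, ContinuousOn (z i) (Icc a b)) (hB : ∀ i, ContinuousOn (B i) (Icc a b))
    (hz' : ∀ i, ∀ s ∈ Ico a b, HasDerivWithinAt (z i) (∑ l, M s i l * z l s + g i s) (Ici s) s)
    (hB' : ∀ i, ∀ s ∈ Ico a b, HasDerivWithinAt (B i) (B' i s) (Ici s) s)
    (hM : ∀ s ∈ Ico a b, ∀ i l, l ≠ i → 0 ≤ M s i l)
    (hlt : ∀ s ∈ Ico a b, ∀ i, ∑ l, M s i l * B l s + |g i s| < B' i s)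
    (h0 : ∀ i, |z i a| ≤ B i a) : ∀ s ∈ Icc a b, ∀ i, |z i s| ≤ B i s := by
  have hclosed : IsClosed ({s | ∀ i, |z i s| ≤ B i s} ∩ Icc a b) := by
    have : {s | ∀ i, |z i s| ≤ B i s} ∩ Icc a b
        = (⋂ i, {s ∈ Icc a b | |z i s| ≤ B i s}) ∩ Icc a b := by
      ext s
      simp only [mem_inter_iff, mem_ofPred_eq, mem_iInter]
      exact ⟨fun h => ⟨fun i => ⟨h.2, h.1 i⟩, h.2⟩, fun h => ⟨fun i => (h.1 i).2, h.2⟩⟩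
    rw [this]
    exact (isClosed_iInter fun i => isClosed_Icc.isClosed_le (hz i).abs (hB i)).inter isClosed_Icc
  have step : ∀ {z' g' : ι → ℝ → ℝ} {s : ℝ}, s ∈ Ico a b → ∀ i,
      HasDerivWithinAt (z' i) (∑ l, M s i l * z' l s + g' i s) (Ici s) s →
      (∀ l, z' l s ≤ B l s) → |g' i s| = |g i s| → ∀ᶠ r in 𝓝[>] s, z' i r - B i r ≤ 0 := by
    intro z' g' s hs i hd hle hg
    refine eventually_nonpos_of_deriv_neg (hd.sub (hB' i s hs)) (sub_nonpos.2 (hle i)) fun heq => ?_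
    have heq' : z' i s = B i s := sub_eq_zero.1 heq
    have h1 : ∑ l, M s i l * z' l s ≤ ∑ l, M s i l * B l s := by
      refine Finset.sum_le_sum fun l _ => ?_
      by_cases hl : l = i
      · rw [hl, heq']
      · exact mul_le_mul_of_nonneg_left (hle l) (hM s hs i l hl)
    have h2 := hlt s hs i
    have h3 := le_abs_self (g' i s)
    linarith
  intro s hs
  refine hclosed.Icc_subset_of_forall_mem_nhdsWithin h0 (fun s hs => ?_) hs
  have hle := hs.1
  rw [← eventually_mem_set]
  simp only [mem_ofPred_eq]
  rw [eventually_all]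
  intro i
  have h1 := step (z' := z) (g' := g) hs.2 i (hz' i s hs.2)
    (fun l => (le_abs_self _).trans (hle l)) rfl
  have h2 := step (z' := fun i r => -z i r) (g' := fun i r => -g i r) hs.2 i
    ((hz' i s hs.2).neg.congr_deriv (by
      simp only [mul_neg, Finset.sum_neg_distrib]
      ring))
    (fun l => (neg_le_abs _).trans (hle l)) (abs_neg _)
  filter_upwards [h1, h2] with r hr1 hr2
  exact abs_le'.2 ⟨by linarith, by linarith⟩

/-! ### The chain rule expressions -/

/-- The number of powers of `N⁻¹` gained by a chain rule expression is the number of distinct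
indices other than `i`, as for the variation processes themselves. -/
theorem exists_abs_flowDeriv_le {U V : ℝ → ℝ} {lam KV : ℝ} (h : PotentialAssumption U V lam KV)
    {D : ℝ} (hD : 0 ≤ D) : ∀ k : ℕ, ∃ C : ℝ, 0 ≤ C ∧ ∀ N : ℕ, 1 ≤ N → ∀ (i : Fin N)
      (x : Fin N → ℝ) (y : List (Fin N) → Fin N → ℝ),
      (∀ v : List (Fin N), 1 ≤ v.length → v.length ≤ k →
        ∀ l, |y v l| ≤ D * weight (insert l v.toFinset)) →
      ∀ b α : List (Fin N), 1 ≤ b.length → α.length ≤ k → b.length + α.length ≤ 6 →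
        |flowDeriv (drift U V i) x y b α|
          ≤ C * weight (insert i (b.toFinset ∪ α.toFinset)) := by
  obtain ⟨C₀, hC₀, hdrift⟩ := exists_abs_partialDeriv_drift_le h
  intro k
  induction k with
  | zero =>
      refine ⟨C₀, hC₀, fun N hN i x y _ b α hb hα hlen => ?_⟩
      obtain rfl : α = [] := List.eq_nil_of_length_eq_zero (by omega)
      rw [flowDeriv_nil]
      simpa using hdrift N hN i b hb (by simpa using hlen) x
  | succ k ih =>
      obtain ⟨C, hC, ih⟩ := ih
      refine ⟨C₀ + 2 ^ k * (C * D * 8), by positivity, fun N hN i x y hy b α hb hα hlen => ?_⟩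
      have hw := weight_pos hN (insert i (b.toFinset ∪ α.toFinset))
      rcases α with - | ⟨a, α⟩
      · rw [flowDeriv_nil]
        refine (hdrift N hN i b hb (by simpa using hlen) x).trans ?_
        simp only [List.toFinset_nil, Finset.union_empty] at hw ⊢
        gcongr
        have : 0 ≤ 2 ^ k * (C * D * 8) := by positivity
        linarith
      · simp only [List.length_cons] at hα hlen
        rw [flowDeriv_cons]
        set S := insert i (b.toFinset ∪ (a :: α).toFinset) with hS
        have hterm : ∀ q ∈ unshuffles α,
            |∑ l, flowDeriv (drift U V i) x y (l :: b) q.1 * y (a :: q.2) l|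
              ≤ C * D * 8 * weight S := by
          intro q hq
          have hqlen := length_of_mem_unshuffles hq
          have hunion : insert i (b.toFinset ∪ q.1.toFinset) ∪ (a :: q.2).toFinset = S := by
            rw [hS, List.toFinset_cons, List.toFinset_cons, ← toFinset_of_mem_unshuffles hq]
            ext l
            simp only [Finset.mem_union, Finset.mem_insert]
            tauto
          have hcard : (S.card : ℝ) + 1 ≤ 8 := by
            have h1 := Finset.card_insert_le i (b.toFinset ∪ (a :: α).toFinset)
            have h2 := Finset.card_union_le b.toFinset (a :: α).toFinset
            have h3 := b.toFinset_card_le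
            have h4 := (a :: α).toFinset_card_le
            simp only [List.length_cons] at h4
            have : S.card + 1 ≤ 8 := by rw [hS]; omega
            exact_mod_cast this
          have hmain := abs_sum_mul_le hN (insert i (b.toFinset ∪ q.1.toFinset))
            (a :: q.2).toFinset hC hD
            (f := fun l => flowDeriv (drift U V i) x y (l :: b) q.1) (g := fun l => y (a :: q.2) l)
            (fun l => by
              have := ih N hN i x y (fun v hv1 hv2 => hy v hv1 (by omega)) (l :: b) q.1
                (by simp) (by omega) (by simp only [List.length_cons]; omega)
              rwa [List.toFinset_cons, Finset.insert_union, Finset.insert_comm] at this)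
            (fun l => hy (a :: q.2) (by simp) (by simp only [List.length_cons]; omega) l)
          rw [hunion] at hmain
          exact hmain.trans (by gcongr)
        refine (abs_list_sum_map_le _ _ hterm).trans ?_
        rw [length_unshuffles]
        have h2 : ((2 ^ α.length : ℕ) : ℝ) ≤ 2 ^ k := by
          push_cast
          exact pow_le_pow_right₀ (by norm_num) (by omega)
        calc ((2 ^ α.length : ℕ) : ℝ) * (C * D * 8 * weight S)
            ≤ 2 ^ k * (C * D * 8 * weight S) := by gcongr
          _ ≤ C₀ * weight S + 2 ^ k * (C * D * 8 * weight S) :=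
              le_add_of_nonneg_left (by positivity)
          _ = _ := by ring

theorem continuousOn_list_sum_map {A : Type*} (L : List A) {F : A → ℝ → ℝ} {S : Set ℝ}
    (h : ∀ q ∈ L, ContinuousOn (F q) S) : ContinuousOn (fun s => (L.map fun q => F q s).sum) S := by
  induction L with
  | nil => simpa using continuousOn_const
  | cons a L ih =>
      simp only [List.map_cons, List.sum_cons]
      exact (h a (by simp)).add (ih fun q hq => h q (by simp [hq]))

theorem continuousOn_flowDeriv {U V : ℝ → ℝ} (hU : ContDiff ℝ 7 U) (hV : ContDiff ℝ 7 V) {N : ℕ}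
    (i : Fin N) {S : Set ℝ} {X : ℝ → Fin N → ℝ} (hX : ContinuousOn X S)
    {Y : List (Fin N) → Fin N → ℝ → ℝ} : ∀ k : ℕ,
    (∀ v : List (Fin N), 1 ≤ v.length → v.length ≤ k → ∀ l, ContinuousOn (Y v l) S) →
    ∀ b α : List (Fin N), α.length ≤ k → b.length + α.length ≤ 6 →
      ContinuousOn (fun s => flowDeriv (drift U V i) (X s) (fun v l => Y v l s) b α) S := by
  have hnil : ∀ b : List (Fin N), b.length ≤ 6 → ∀ Y : List (Fin N) → Fin N → ℝ → ℝ,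
      ContinuousOn (fun s => flowDeriv (drift U V i) (X s) (fun v l => Y v l s) b []) S := by
    intro b hb Y
    simp only [flowDeriv_nil]
    exact (continuous_partialDeriv_drift hU hV i b hb).comp_continuousOn hX
  intro k
  induction k with
  | zero =>
      intro _ b α hα hlen
      obtain rfl : α = [] := List.eq_nil_of_length_eq_zero (by omega)
      exact hnil b (by simpa using hlen) Y
  | succ k ih =>
      intro hY b α hα hlen
      rcases α with - | ⟨a, α⟩
      · exact hnil b (by simpa using hlen) Y
      · simp only [List.length_cons] at hα hlen
        simp only [flowDeriv_cons]
        refine continuousOn_list_sum_map _ fun q hq => continuousOn_finsetSum _ fun l _ => ?_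
        have hqlen := length_of_mem_unshuffles hq
        exact (ih (fun v hv1 hv2 => hY v hv1 (by omega)) (l :: b) q.1 (by omega)
          (by simp only [List.length_cons]; omega)).mul
          (hY (a :: q.2) (by simp) (by simp only [List.length_cons]; omega) l)

/-- The inhomogeneity of the variation equation of the word `w`: the part of the rate that does
not contain the variation process of the full word `w`. -/
noncomputable def variationSource (U V : ℝ → ℝ) {N : ℕ} (x : Fin N → ℝ)
    (y : List (Fin N) → Fin N → ℝ) (i : Fin N) : List (Fin N) → ℝ
  | [] => 0
  | a :: w => (((unshuffles w).filter fun q => 0 < q.1.length).map fun q =>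
      ∑ l : Fin N, flowDeriv (drift U V i) x y [l] q.1 * y (a :: q.2) l).sum

theorem variationRate_eq (U V : ℝ → ℝ) {N : ℕ} (x : Fin N → ℝ) (y : List (Fin N) → Fin N → ℝ)
    (i : Fin N) {w : List (Fin N)} (hw : 1 ≤ w.length) :
    variationRate U V x y i w = (∑ l, partialDeriv (drift U V i) [l] x * y w l)
      + variationSource U V x y i w := by
  obtain ⟨a, w, rfl⟩ := List.exists_cons_of_length_pos hw
  rfl

/-- The source only involves variation processes of lower order, and inherits their size and,
from the factor outside the chain rule expression, their decay `e`. -/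
theorem exists_abs_variationSource_le {U V : ℝ → ℝ} {lam KV : ℝ}
    (h : PotentialAssumption U V lam KV) {D : ℝ} (hD : 0 ≤ D) {n : ℕ} (hn : n + 1 ≤ 6) :
    ∃ G : ℝ, 0 ≤ G ∧ ∀ N : ℕ, 1 ≤ N → ∀ (i : Fin N)
      (x : Fin N → ℝ) (y : List (Fin N) → Fin N → ℝ) (e : ℝ), 0 ≤ e → e ≤ 1 →
      (∀ v : List (Fin N), 1 ≤ v.length → v.length ≤ n →
        ∀ l, |y v l| ≤ D * e * weight (insert l v.toFinset)) →
      ∀ w : List (Fin N), w.length ≤ n + 1 →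
        |variationSource U V x y i w| ≤ G * e * weight (insert i w.toFinset) := by
  obtain ⟨C, hC, hflow⟩ := exists_abs_flowDeriv_le h hD n
  refine ⟨2 ^ n * (C * D * 8), by positivity, fun N hN i x y e he0 he1 hy w hw => ?_⟩
  have hpos := weight_pos hN (insert i w.toFinset)
  rcases w with - | ⟨a, w⟩
  · simp only [variationSource, abs_zero]
    positivity
  simp only [List.length_cons] at hw
  rw [variationSource]
  set S := insert i (a :: w).toFinset with hS
  have hterm : ∀ q ∈ (unshuffles w).filter fun q => 0 < q.1.length,
      |∑ l, flowDeriv (drift U V i) x y [l] q.1 * y (a :: q.2) l|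
        ≤ C * (D * e) * 8 * weight S := by
    intro q hq
    obtain ⟨hq, hq0⟩ := List.mem_filter.1 hq
    simp only [decide_eq_true_eq] at hq0
    have hqlen := length_of_mem_unshuffles hq
    have hunion : insert i q.1.toFinset ∪ (a :: q.2).toFinset = S := by
      rw [hS, List.toFinset_cons, List.toFinset_cons, ← toFinset_of_mem_unshuffles hq]
      ext l
      simp only [Finset.mem_union, Finset.mem_insert]
      tauto
    have hcard : (S.card : ℝ) + 1 ≤ 8 := by
      have h1 := Finset.card_insert_le i (a :: w).toFinset
      have h2 := (a :: w).toFinset_card_le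
      simp only [List.length_cons] at h2
      have : S.card + 1 ≤ 8 := by rw [hS]; omega
      exact_mod_cast this
    have hmain := abs_sum_mul_le hN (insert i q.1.toFinset)
      (a :: q.2).toFinset hC (mul_nonneg hD he0)
      (f := fun l => flowDeriv (drift U V i) x y [l] q.1) (g := fun l => y (a :: q.2) l)
      (fun l => by
        have := hflow N hN i x y (fun v hv1 hv2 l => (hy v hv1 hv2 l).trans (by
            have := weight_pos hN (insert l v.toFinset)
            gcongr
            exact mul_le_of_le_one_right hD he1)) [l] q.1
          (by simp) (by omega) (by simp only [List.length_cons, List.length_nil]; omega)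
        rwa [List.toFinset_cons, List.toFinset_nil, Finset.insert_union, Finset.empty_union,
          Finset.insert_comm] at this)
      (fun l => hy (a :: q.2) (by simp) (by simp only [List.length_cons]; omega) l)
    rw [hunion] at hmain
    exact hmain.trans (by gcongr)
  refine (abs_list_sum_map_le _ _ hterm).trans ?_
  have h2 : (((unshuffles w).filter fun q => 0 < q.1.length).length : ℝ) ≤ 2 ^ n := by
    have h3 := List.length_filter_le (fun q => decide (0 < q.1.length)) (unshuffles w)
    rw [length_unshuffles] at h3
    calc _ ≤ ((2 ^ w.length : ℕ) : ℝ) := by exact_mod_cast h3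
      _ ≤ 2 ^ n := by
        push_cast
        exact pow_le_pow_right₀ (by norm_num) (by omega)
  calc _ ≤ 2 ^ n * (C * (D * e) * 8 * weight S) := by gcongr
    _ = _ := by ring

theorem continuousOn_variationSource {U V : ℝ → ℝ} (hU : ContDiff ℝ 7 U) (hV : ContDiff ℝ 7 V)
    {N : ℕ} (i : Fin N) {S : Set ℝ} {X : ℝ → Fin N → ℝ} (hX : ContinuousOn X S)
    {Y : List (Fin N) → Fin N → ℝ → ℝ} {n : ℕ} (hn : n ≤ 6)
    (hY : ∀ v : List (Fin N), 1 ≤ v.length → v.length ≤ n → ∀ l, ContinuousOn (Y v l) S)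
    {w : List (Fin N)} (hw : w.length ≤ n) :
    ContinuousOn (fun s => variationSource U V (X s) (fun v l => Y v l s) i w) S := by
  rcases w with - | ⟨a, w⟩
  · exact continuousOn_const
  simp only [List.length_cons] at hw
  refine continuousOn_list_sum_map _ fun q hq => continuousOn_finsetSum _ fun l _ => ?_
  have hqlen := length_of_mem_unshuffles (List.mem_filter.1 hq).1
  exact (continuousOn_flowDeriv hU hV i hX n hY [l] q.1 (by omega)
    (by simp only [List.length_cons, List.length_nil]; omega)).mul
    (hY (a :: q.2) (by simp) (by simp only [List.length_cons]; omega) l)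

/-! ### Pathwise bounds for the variation processes -/

/-- The spatial profile of the supersolution for the variation equation of a word with set of
letters `S`: the particles in `S` have size `weight S`, the others are smaller by a factor `N⁻¹`.
The smaller part is added for all particles, so that the profile is largest on `S` whatever the
constants and `N` are. -/
noncomputable def profile {N : ℕ} (C₁ C₂ : ℝ) (S : Finset (Fin N)) (l : Fin N) : ℝ :=
  (if l ∈ S then C₁ * weight S else 0) + C₂ * ((N : ℝ)⁻¹ * weight S)

theorem profile_le {N : ℕ} (hN : 1 ≤ N) {C₁ C₂ : ℝ} (h₁ : 0 ≤ C₁) (h₂ : 0 ≤ C₂)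
    (S : Finset (Fin N)) (l : Fin N) :
    profile C₁ C₂ S l ≤ (C₁ + C₂) * weight (insert l S) := by
  have hw := weight_pos hN S
  have hinv : (N : ℝ)⁻¹ ≤ 1 := inv_le_one_of_one_le₀ (by exact_mod_cast hN)
  unfold profile
  by_cases hl : l ∈ S
  · rw [if_pos hl, Finset.insert_eq_of_mem hl, add_mul]
    gcongr
    exact mul_le_of_le_one_left hw.le hinv
  · rw [if_neg hl, weight_insert_of_notMem hl, zero_add]
    gcongr
    linarith

/-- On `S` the interaction can only decrease the profile; off `S` it transports at most `card S`
contributions of size `N⁻¹ * weight S`, which are absorbed by `C₂`. -/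
theorem interaction_profile_lt {N : ℕ} (hN : 1 ≤ N) {C₁ C₂ KV G μ : ℝ} (hμ : 0 < μ)
    (S : Finset (Fin N)) {v : Fin N → ℝ} (hv : ∀ j, 0 ≤ v j ∧ v j ≤ KV)
    (h₁ : G < μ * C₁) (h₂ : KV * S.card * C₁ + G < μ * C₂) (hC₁ : 0 ≤ C₁) (hC₂ : 0 ≤ C₂)
    (i : Fin N) :
    (1 / (N : ℝ)) * ∑ j, v j * (profile C₁ C₂ S j - profile C₁ C₂ S i)
      + G * weight (insert i S) < μ * profile C₁ C₂ S i := by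
  have hw := weight_pos hN S
  have hN0 : (0 : ℝ) < N := by exact_mod_cast hN
  have hdiff : ∀ j, profile C₁ C₂ S j - profile C₁ C₂ S i
      = (if j ∈ S then C₁ * weight S else 0) - (if i ∈ S then C₁ * weight S else 0) :=
    fun j => by unfold profile; ring
  simp only [hdiff]
  by_cases hi : i ∈ S
  · have hsum : ∑ j, v j * ((if j ∈ S then C₁ * weight S else 0)
        - (if i ∈ S then C₁ * weight S else 0)) ≤ 0 := by
      refine Finset.sum_nonpos fun j _ => mul_nonpos_of_nonneg_of_nonpos (hv j).1 ?_
      have : 0 ≤ C₁ * weight S := by positivity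
      rw [if_pos hi]
      split_ifs <;> linarith
    have hsum' := mul_nonpos_of_nonneg_of_nonpos (by positivity : 0 ≤ 1 / (N : ℝ)) hsum
    rw [profile, if_pos hi, Finset.insert_eq_of_mem hi]
    rw [if_pos hi] at hsum'
    have h3 := mul_lt_mul_of_pos_right h₁ hw
    have h4 : 0 ≤ μ * (C₂ * ((N : ℝ)⁻¹ * weight S)) := by positivity
    linarith
  · have hsum : ∑ j, v j * ((if j ∈ S then C₁ * weight S else 0)
        - (if i ∈ S then C₁ * weight S else 0)) ≤ KV * S.card * C₁ * weight S := by
      calc _ ≤ ∑ j, (if j ∈ S then KV * (C₁ * weight S) else 0) := by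
            refine Finset.sum_le_sum fun j _ => ?_
            rw [if_neg hi, sub_zero]
            split_ifs
            · exact mul_le_mul_of_nonneg_right (hv j).2 (by positivity)
            · simp
        _ = _ := by
            simp
            ring
    rw [profile, weight_insert_of_notMem hi]
    rw [if_neg hi] at hsum ⊢
    have hpos : 0 < (N : ℝ)⁻¹ * weight S := by positivity
    calc _ ≤ 1 / (N : ℝ) * (KV * S.card * C₁ * weight S) + G * ((N : ℝ)⁻¹ * weight S) := by gcongr
      _ = (KV * S.card * C₁ + G) * ((N : ℝ)⁻¹ * weight S) := by rw [one_div]; ring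
      _ < μ * C₂ * ((N : ℝ)⁻¹ * weight S) := mul_lt_mul_of_pos_right h₂ hpos
      _ = _ := by ring

open Set in
theorem hasDerivWithinAt_of_integral_eq {a b c : ℝ} {z R : ℝ → ℝ} (hR : ContinuousOn R (Icc a b))
    (hz : ∀ s ∈ Icc a b, z s = c + ∫ u in a..s, R u) {s : ℝ} (hs : s ∈ Ico a b) :
    HasDerivWithinAt z (R s) (Ici s) s := by
  have hnhds : Icc a b ∈ nhdsWithin s (Ici s) := Icc_mem_nhdsGE_of_mem hs
  have hnhds' : Icc a b ∈ nhdsWithin s (Ioi s) := nhdsWithin_mono s Ioi_subset_Ici_self hnhds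
  have hs' : s ∈ Icc a b := Ico_subset_Icc_self hs
  have hint : IntervalIntegrable R volume a s :=
    (hR.mono (Icc_subset_Icc_right hs'.2)).intervalIntegrable_of_Icc hs'.1
  have hmeas : StronglyMeasurableAtFilter R (nhdsWithin s (Ioi s)) volume :=
    ⟨Icc a b, hnhds', hR.aestronglyMeasurable measurableSet_Icc⟩
  have hcont : ContinuousWithinAt R (Ioi s) s := (hR s hs').mono_of_mem_nhdsWithin hnhds'
  have hd := (intervalIntegral.integral_hasDerivWithinAt_right hint (s := Ici s) hmeas
    hcont).const_add c
  refine hd.congr_of_eventuallyEq ?_ (hz s hs')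
  filter_upwards [hnhds] with r hr using hz r hr

theorem abs_variationInit_le {N : ℕ} (hN : 1 ≤ N) {C₁ C₂ : ℝ} (h₁ : 1 ≤ C₁) (h₂ : 0 ≤ C₂)
    (i : Fin N) (w : List (Fin N)) : |variationInit i w| ≤ profile C₁ C₂ w.toFinset i := by
  have hw := weight_pos hN w.toFinset
  unfold variationInit profile
  by_cases h : w = [i]
  · subst h
    simp only [if_true, List.toFinset_cons, List.toFinset_nil, insert_empty_eq,
      Finset.mem_singleton, weight_singleton hN, abs_one]
    have : 0 ≤ C₂ * ((N : ℝ)⁻¹ * 1) := by positivity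
    linarith
  · rw [if_neg h, abs_zero]
    split_ifs <;> positivity

open Set in
/-- Along every path, the variation processes decay exponentially and have the size of the weight
of their set of indices, uniformly in the path of the flow. -/
theorem exists_abs_variation_le {U V : ℝ → ℝ} {lam KV : ℝ} (h : PotentialAssumption U V lam KV) :
    ∀ n : ℕ, n ≤ 6 → ∃ C : ℝ, 0 ≤ C ∧ ∀ N : ℕ, 1 ≤ N → ∀ (a b : ℝ) (X : ℝ → Fin N → ℝ),
      a ≤ b → ContinuousOn X (Icc a b) → ∀ Y : List (Fin N) → Fin N → ℝ → ℝ,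
      (∀ w : List (Fin N), 1 ≤ w.length → w.length ≤ n → ∀ i, ContinuousOn (Y w i) (Icc a b)) →
      (∀ w : List (Fin N), 1 ≤ w.length → w.length ≤ n → ∀ i, ∀ s ∈ Icc a b,
        Y w i s = variationInit i w
          + ∫ u in a..s, variationRate U V (X u) (fun v l => Y v l u) i w) →
      ∀ w : List (Fin N), 1 ≤ w.length → w.length ≤ n → ∀ i, ∀ s ∈ Icc a b,
        |Y w i s| ≤ C * Real.exp (-(lam / 2) * (s - a)) * weight (insert i w.toFinset) := by
  intro n
  induction n with
  | zero => exact fun _ => ⟨0, le_rfl, fun _ _ _ _ _ _ _ _ _ _ w hw1 hw2 => by omega⟩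
  | succ n ih =>
    intro hn
    obtain ⟨D, hD, ih⟩ := ih (by omega)
    obtain ⟨G, hG, hsource⟩ := exists_abs_variationSource_le h hD hn
    set μ := lam / 2 with hμ_def
    have hμ : 0 < μ := half_pos h.lam_pos
    have hKV := h.KV_pos
    -- the constants are chosen for `interaction_profile_lt`; `1 ≤ C₁` serves the initial value `1`
    -- of the first variation
    set C₁ := G / μ + 1 with hC₁_def
    have hC₁ : 1 ≤ C₁ := le_add_of_nonneg_left (by positivity)
    have hC₁' : G < μ * C₁ := by
      rw [hC₁_def, mul_add, mul_div_cancel₀ _ hμ.ne']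
      linarith
    set C₂ := (KV * (n + 1) * C₁ + G) / μ + 1 with hC₂_def
    have hC₂ : 0 ≤ C₂ := by positivity
    have hC₂' : KV * (n + 1) * C₁ + G < μ * C₂ := by
      rw [hC₂_def, mul_add μ, mul_div_cancel₀ _ hμ.ne']
      linarith
    refine ⟨C₁ + C₂, by positivity, fun N hN a b X hab hX Y hY heq w hw1 hw2 i s hs => ?_⟩
    have hlow : ∀ v : List (Fin N), 1 ≤ v.length → v.length ≤ n → ∀ l, ∀ r ∈ Icc a b,
        |Y v l r| ≤ D * Real.exp (-μ * (r - a)) * weight (insert l v.toFinset) :=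
      ih N hN a b X hab hX Y (fun v hv1 hv2 => hY v hv1 (by omega))
        (fun v hv1 hv2 => heq v hv1 (by omega))
    have hcard : KV * w.toFinset.card * C₁ + G < μ * C₂ := by
      have h1 : (w.toFinset.card : ℝ) ≤ n + 1 := by
        exact_mod_cast w.toFinset_card_le.trans hw2
      refine lt_of_le_of_lt ?_ hC₂'
      gcongr
    have hcomparison := abs_le_of_strict_supersolution (a := a) (b := b)
      (z := fun l r => Y w l r)
      (g := fun l r => variationSource U V (X r) (fun v l => Y v l r) l w)
      (B := fun l r => Real.exp (-μ * (r - a)) * profile C₁ C₂ w.toFinset l)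
      (B' := fun l r => Real.exp (-μ * (r - a)) * (-μ) * profile C₁ C₂ w.toFinset l)
      (M := fun r i l => partialDeriv (drift U V i) [l] (X r))
      (fun l => hY w hw1 hw2 l)
      (fun l => by fun_prop)
      (fun l r hr => by
        have hcont : ContinuousOn
            (fun u => variationRate U V (X u) (fun v l => Y v l u) l w) (Icc a b) := by
          simp only [fun u => variationRate_eq U V (X u) (fun v l => Y v l u) l hw1]
          refine (continuousOn_finsetSum _ fun j _ => ?_).add
            (continuousOn_variationSource h.contDiff_U h.contDiff_V l hX hn hY hw2)
          exact ((continuous_partialDeriv_drift h.contDiff_U h.contDiff_V l [j]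
            (by simp)).comp_continuousOn hX).mul (hY w hw1 hw2 j)
        have := hasDerivWithinAt_of_integral_eq hcont (heq w hw1 hw2 l) hr
        rwa [variationRate_eq _ _ _ _ _ hw1] at this)
      (fun l r _ => by
        have : HasDerivAt (fun r => Real.exp (-μ * (r - a))) (Real.exp (-μ * (r - a)) * (-μ)) r := by
          simpa using (((hasDerivAt_id r).sub_const a).const_mul (-μ)).exp
        exact (this.mul_const _).hasDerivWithinAt)
      (fun r _ i l hil => partialDeriv_drift_nonneg h.contDiff_U h.contDiff_V
        h.hessian_V_nonneg hil _)
      (fun r hr l => by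
        have hr' := Ico_subset_Icc_self hr
        have he := Real.exp_pos (-μ * (r - a))
        have he1 : Real.exp (-μ * (r - a)) ≤ 1 := by
          rw [Real.exp_le_one_iff]
          have := mul_nonneg hμ.le (sub_nonneg.2 hr.1)
          linarith
        have hg := hsource N hN l (X r) (fun v l => Y v l r) _ he.le he1
          (fun v hv1 hv2 l => hlow v hv1 hv2 l r hr') w hw2
        have hprofile := interaction_profile_lt hN hμ w.toFinset
          (v := fun j => iteratedDeriv 2 V (X r l - X r j))
          (fun j => ⟨h.hessian_V_nonneg _, (le_abs_self _).trans (h.hessian_V_le _)⟩)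
          hC₁' hcard (by linarith) hC₂ l
        have hpl : 0 ≤ profile C₁ C₂ w.toFinset l :=
          (abs_nonneg _).trans (abs_variationInit_le hN hC₁ hC₂ l w)
        -- half of the confinement `lam = 2 * μ` is spent on the decay of the barrier
        have hconf : 2 * μ * profile C₁ C₂ w.toFinset l
            ≤ iteratedDeriv 2 U (X r l) * profile C₁ C₂ w.toFinset l := by
          have := h.lam_le (X r l)
          have h2 : 2 * μ = lam := by rw [hμ_def]; ring
          rw [h2]
          gcongr
        have hfactor : ∑ j, partialDeriv (drift U V l) [j] (X r)
              * (Real.exp (-μ * (r - a)) * profile C₁ C₂ w.toFinset j)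
            = Real.exp (-μ * (r - a)) * ∑ j, partialDeriv (drift U V l) [j] (X r)
              * profile C₁ C₂ w.toFinset j := by
          rw [Finset.mul_sum]
          exact Finset.sum_congr rfl fun j _ => by ring
        rw [hfactor, sum_partialDeriv_drift_mul h.contDiff_U h.contDiff_V]
        have hlt : -(iteratedDeriv 2 U (X r l) * profile C₁ C₂ w.toFinset l)
            + 1 / (N : ℝ) * ∑ j, iteratedDeriv 2 V (X r l - X r j)
              * (profile C₁ C₂ w.toFinset j - profile C₁ C₂ w.toFinset l)
            + G * weight (insert l w.toFinset) < -μ * profile C₁ C₂ w.toFinset l := by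
          linarith
        have := mul_lt_mul_of_pos_left hlt he
        linarith)
      (fun l => by
        rw [heq w hw1 hw2 l a (left_mem_Icc.2 hab)]
        simpa using abs_variationInit_le hN hC₁ hC₂ l w)
      s hs i
    refine hcomparison.trans ?_
    calc Real.exp (-μ * (s - a)) * profile C₁ C₂ w.toFinset i
        ≤ Real.exp (-μ * (s - a)) * ((C₁ + C₂) * weight (insert i w.toFinset)) := by
          gcongr
          exact profile_le hN (by linarith) hC₂ _ _
      _ = (C₁ + C₂) * Real.exp (-μ * (s - a)) * weight (insert i w.toFinset) := by ring

/-! ### Multi-indices -/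

theorem orderHat_eq_card_image {n N : ℕ} (γ : Fin n → Fin N) :
    orderHat γ = (Finset.univ.image γ).card := by
  unfold orderHat frequency
  congr 1
  ext j
  simp [Finset.filter_eq_empty_iff]

theorem orderHat_eq_card_insert {n N : ℕ} (γ : Fin (n + 1) → Fin N) :
    orderHat γ = (insert (γ 0) (List.ofFn fun k : Fin n => γ k.succ).toFinset).card := by
  rw [orderHat_eq_card_image]
  congr 1
  ext j
  simp [List.mem_ofFn, Fin.exists_fin_succ, eq_comm]

theorem card_orderHat_eq_le {n N m : ℕ} :
    (Finset.univ.filter fun γ : Fin n → Fin N => orderHat γ = m).card ≤ m ^ n * N ^ m := by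
  classical
  -- a multi-index with `m` distinct values factors through `Fin m`
  have hsub : (Finset.univ.filter fun γ : Fin n → Fin N => orderHat γ = m)
      ⊆ Finset.univ.image fun q : (Fin n → Fin m) × (Fin m → Fin N) => q.2 ∘ q.1 := by
    intro γ hγ
    simp only [Finset.mem_filter, Finset.mem_univ, true_and, orderHat_eq_card_image] at hγ
    simp only [Finset.mem_image, Finset.mem_univ, true_and, Prod.exists]
    let e := Finset.equivFinOfCardEq hγ
    exact ⟨fun k => e ⟨γ k, Finset.mem_image_of_mem γ (Finset.mem_univ k)⟩,
      fun k => (e.symm k : Fin N), by funext k; simp⟩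
  refine (Finset.card_le_card hsub).trans (Finset.card_image_le.trans ?_)
  simp

/-! ### Moments -/

open Set in
theorem exists_ae_abs_component_le {U V : ℝ → ℝ} {lam KV : ℝ} (h : PotentialAssumption U V lam KV)
    {n : ℕ} (hn1 : 1 ≤ n) (hn6 : n ≤ 6) :
    ∃ C : ℝ, 0 ≤ C ∧ ∀ (N : ℕ), 1 ≤ N → ∀ (Ω : Type*) [mΩ : MeasurableSpace Ω] (P : Measure Ω)
      (𝓕 : Filtration ℝ≥0 mΩ) (t s T : ℝ≥0), t ≤ s → s ≤ T → ∀ X : ℝ≥0 → Ω → Fin N → ℝ,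
      (∀ᵐ ω ∂P, ContinuousOn (fun r => X r ω) (Icc t T)) →
      ∀ Y : List (Fin N) → Fin N → ℝ≥0 → Ω → ℝ, IsVariationProcess P 𝓕 U V t T X n Y →
      ∀ γ : Fin (n + 1) → Fin N, ∀ᵐ ω ∂P, |component Y γ s ω|
        ≤ C * Real.exp (-(lam / 2) * ((s : ℝ) - t)) * ((N : ℝ) * (N : ℝ)⁻¹ ^ orderHat γ) := by
  obtain ⟨C, hC0, hC⟩ := exists_abs_variation_le h n hn6
  refine ⟨C, hC0, fun N hN Ω mΩ P 𝓕 t s T hts hsT X hX Y hY γ => ?_⟩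
  have hcont : ∀ᵐ ω ∂P, ∀ w : List (Fin N), 1 ≤ w.length → w.length ≤ n → ∀ i,
      ContinuousOn (fun r => Y w i r ω) (Icc t T) := by
    simp only [ae_all_iff]
    exact hY.continuousOn
  have heq : ∀ᵐ ω ∂P, ∀ w : List (Fin N), 1 ≤ w.length → w.length ≤ n → ∀ i, ∀ r ∈ Icc t T,
      Y w i r ω = variationInit i w + ∫ u in (t : ℝ)..(r : ℝ),
        variationRate U V (X u.toNNReal ω) (fun v l => Y v l u.toNNReal ω) i w := by
    simp only [ae_all_iff]
    exact hY.equation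
  have hmaps : MapsTo Real.toNNReal (Icc (t : ℝ) T) (Icc t T) := fun r hr =>
    ⟨NNReal.le_toNNReal_of_coe_le hr.1, Real.toNNReal_le_iff_le_coe.2 hr.2⟩
  filter_upwards [hX, hcont, heq] with ω h1 h2 h3
  have := hC N hN t T (fun r => X r.toNNReal ω) (by exact_mod_cast hts.trans hsT)
    (h1.comp continuous_real_toNNReal.continuousOn hmaps) (fun w i r => Y w i r.toNNReal ω)
    (fun w hw1 hw2 i => (h2 w hw1 hw2 i).comp continuous_real_toNNReal.continuousOn hmaps)
    (fun w hw1 hw2 i r hr => by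
      have := h3 w hw1 hw2 i r.toNNReal (hmaps hr)
      rwa [Real.coe_toNNReal r (t.coe_nonneg.trans hr.1)] at this)
    (List.ofFn fun k : Fin n => γ k.succ) (by simpa using hn1) (by simp) (γ 0) s
    ⟨by exact_mod_cast hts, by exact_mod_cast hsT⟩
  rw [Real.toNNReal_coe, weight, ← orderHat_eq_card_insert] at this
  exact this

end IPSVariation

theorem lemma4p6 (U V : ℝ → ℝ) (lam KV σ p : ℝ)
    (hUV : IPSVariation.PotentialAssumption U V lam KV) (hp : 2 ≤ p)
    (n : ℕ) (hn1 : 1 ≤ n) (hn6 : n ≤ 6) :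
    ∃ lam0 K1 K2 : ℝ, 0 < lam0 ∧ lam0 < lam ∧ 0 < K1 ∧ 0 < K2 ∧
      ∀ (N : ℕ), 1 ≤ N →
      ∀ (Ω : Type*) [mΩ : MeasurableSpace Ω] (P : Measure Ω) [IsProbabilityMeasure P]
        (𝓕 : Filtration ℝ≥0 mΩ) (W : Fin N → ℝ≥0 → Ω → ℝ),
        IPSVariation.IsFilteredBrownian P 𝓕 W →
      ∀ (t s T : ℝ≥0), t ≤ s → s ≤ T →
      ∀ (x : Fin N → Ω → ℝ),
        (∀ i, Measurable[𝓕 t] (x i)) → (∀ i, MemLp (x i) 2 P) →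
        (∀ i j, IdentDistrib (x i) (x j) P P) →
      ∀ (X : ℝ≥0 → Ω → Fin N → ℝ), IPSVariation.IsParticleFlow P 𝓕 U V σ W t T x X →
      ∀ (Y : List (Fin N) → Fin N → ℝ≥0 → Ω → ℝ),
        IPSVariation.IsVariationProcess P 𝓕 U V t T X n Y →
        (∀ γ : Fin (n + 1) → Fin N,
          Integrable (fun ω => |IPSVariation.component Y γ s ω| ^ p) P) ∧
        ∀ m : ℕ, 1 ≤ m → m ≤ n + 1 →
          (∑ γ : Fin (n + 1) → Fin N with IPSVariation.orderHat γ = m,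
              ∫ ω, |IPSVariation.component Y γ s ω| ^ p ∂P
            ≤ K1 / (N : ℝ) ^ (p * ((m : ℝ) - 1) - (m : ℝ))
                * Real.exp (-lam0 * p * ((s : ℝ) - (t : ℝ)))) ∧
          (∀ γ : Fin (n + 1) → Fin N, IPSVariation.orderHat γ = m →
            ∫ ω, |IPSVariation.component Y γ s ω| ^ p ∂P
              ≤ K2 / (N : ℝ) ^ (p * ((m : ℝ) - 1))
                  * Real.exp (-lam0 * p * ((s : ℝ) - (t : ℝ)))) := by

  obtain ⟨C, hC0, hC⟩ := IPSVariation.exists_ae_abs_component_le hUV hn1 hn6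
  have hlam := hUV.lam_pos
  have hK₂ : 0 < (C + 1) ^ p := Real.rpow_pos_of_pos (by linarith) p
  refine ⟨lam / 2, ((n + 1 : ℕ) : ℝ) ^ (n + 1) * (C + 1) ^ p, (C + 1) ^ p, half_pos hlam,
    half_lt_self hlam, by positivity, hK₂, ?_⟩
  intro N hN Ω mΩ P _ 𝓕 W _ t s T hts hsT x _ _ _ X hX Y hY
  have hN0 : (0 : ℝ) < N := by exact_mod_cast hN
  have hp0 : 0 ≤ p := by linarith
  have hbound : ∀ γ : Fin (n + 1) → Fin N, ∀ᵐ ω ∂P,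
      |IPSVariation.component Y γ s ω| ^ p
        ≤ (C + 1) ^ p / (N : ℝ) ^ (p * ((IPSVariation.orderHat γ : ℝ) - 1))
          * Real.exp (-(lam / 2) * p * ((s : ℝ) - (t : ℝ))) := by
    intro γ
    filter_upwards [hC N hN Ω P 𝓕 t s T hts hsT X hX.continuousOn Y hY γ]
      with ω hω
    have hle : |IPSVariation.component Y γ s ω| ≤ (C + 1)
        * Real.exp (-(lam / 2) * ((s : ℝ) - t))
        * ((N : ℝ) * (N : ℝ)⁻¹ ^ IPSVariation.orderHat γ) := by
      refine hω.trans ?_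
      gcongr
      linarith
    refine (Real.rpow_le_rpow (abs_nonneg _) hle hp0).trans_eq ?_
    have hweight : (N : ℝ) * (N : ℝ)⁻¹ ^ IPSVariation.orderHat γ
        = (N : ℝ) ^ (-((IPSVariation.orderHat γ : ℝ) - 1)) := by
      rw [neg_sub, Real.rpow_sub hN0, Real.rpow_one, Real.rpow_natCast, inv_pow, div_eq_mul_inv]
    rw [hweight, Real.mul_rpow (by positivity) (by positivity),
      Real.mul_rpow (by positivity) (by positivity), ← Real.exp_mul, ← Real.rpow_mul hN0.le,
      div_eq_mul_inv ((C + 1) ^ p), ← Real.rpow_neg hN0.le, mul_right_comm,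
      show -(lam / 2) * ((s : ℝ) - t) * p = -(lam / 2) * p * ((s : ℝ) - t) by ring,
      show -((IPSVariation.orderHat γ : ℝ) - 1) * p
        = -(p * ((IPSVariation.orderHat γ : ℝ) - 1)) by ring]
  have hmeas : ∀ γ : Fin (n + 1) → Fin N,
      Measurable fun ω => |IPSVariation.component Y γ s ω| ^ p := by
    intro γ
    have h1 := (hY.adapted (List.ofFn fun k : Fin n => γ k.succ) (by simpa using hn1) (by simp)
      (γ 0) s ⟨hts, hsT⟩).mono (𝓕.le s) le_rfl
    have h2 : Measurable (IPSVariation.component Y γ s) := h1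
    fun_prop
  have hint : ∀ γ : Fin (n + 1) → Fin N,
      Integrable (fun ω => |IPSVariation.component Y γ s ω| ^ p) P := by
    intro γ
    exact Integrable.of_bound (hmeas γ).aestronglyMeasurable _ ((hbound γ).mono fun ω hω =>
      (Real.norm_of_nonneg (by positivity)).trans_le hω)
  have hmoment : ∀ γ : Fin (n + 1) → Fin N, ∀ m : ℕ, IPSVariation.orderHat γ = m →
      ∫ ω, |IPSVariation.component Y γ s ω| ^ p ∂P
        ≤ (C + 1) ^ p / (N : ℝ) ^ (p * ((m : ℝ) - 1))
          * Real.exp (-(lam / 2) * p * ((s : ℝ) - (t : ℝ))) := by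
    rintro γ m rfl
    refine (integral_mono_ae (hint γ) (integrable_const _) (hbound γ)).trans_eq ?_
    simp
  refine ⟨hint, fun m _ hm => ⟨?_, fun γ hγ => hmoment γ m hγ⟩⟩
  refine (Finset.sum_le_card_nsmul _ _ _ fun γ hγ =>
    hmoment γ m (Finset.mem_filter.1 hγ).2).trans ?_
  have hcard : ((Finset.univ.filter fun γ : Fin (n + 1) → Fin N =>
      IPSVariation.orderHat γ = m).card : ℝ) ≤ ((n + 1 : ℕ) : ℝ) ^ (n + 1) * (N : ℝ) ^ m := by
    have h1 := IPSVariation.card_orderHat_eq_le (n := n + 1) (N := N) (m := m)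
    have h2 : m ^ (n + 1) * N ^ m ≤ (n + 1) ^ (n + 1) * N ^ m := by gcongr
    exact_mod_cast h1.trans h2
  rw [nsmul_eq_mul, Real.rpow_sub hN0, Real.rpow_natCast]
  calc _ ≤ ((n + 1 : ℕ) : ℝ) ^ (n + 1) * (N : ℝ) ^ m
        * ((C + 1) ^ p / (N : ℝ) ^ (p * ((m : ℝ) - 1))
          * Real.exp (-(lam / 2) * p * ((s : ℝ) - (t : ℝ)))) := by gcongr
    _ = _ := by
        rw [div_div_eq_mul_div]
        ring
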